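/- A \emph{$3$-polytope} is a $3$-dimensional convex hull of finitely many points in $\mathbb R^3$. A \emph{stacked $3$-polytope} is one obtained from a tetrahedron by finitely many (possibly zero) stackings, where stacking over a facet $F$ of $P$ replaces $P$ by $\operatorname{conv}(P\cup\{y\})$ for a point $y$ lying strictly beyond the plane of $F$ and strictly beneath the planes of all other facets of $P$. A \emph{Koebe realization} of a $3$-polytope $P$ is a $3$-polytope $Q\subset\mathbb R^3$ whose face lattice is isomorphic to that of $P$ and all of whose edges are tangent to the unit sphere $\mathbb S^2$, the point of tangency lying on the edge. For such $Q$ let $\mathbb Q[Q]\subset\mathbb R$ be the field generated over $\mathbb Q$ by the coordinates of the vertices of $Q$; the \emph{Koebe degree} $\kappa(P)$ is the minimum of $[\mathbb Q[Q]:\mathbb Q]$ over all Koebe realizations $Q$ of $P$. \textbf{Theorem.} Every stacked $3$-polytope $P$ admits a Koebe realization all of whose vertices have rational coordinates; that is, $\kappa(P)=1$. -/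

import Mathlib

namespace KoebePolytope

/-- Euclidean three-space. -/
abbrev E3 : Type := EuclideanSpace ℝ (Fin 3)

/-- A (convex) 3-polytope: the convex hull of finitely many points of `ℝ³`, of dimension three. -/
def IsThreePolytope (P : Set E3) : Prop :=
  (∃ s : Finset E3, P = convexHull ℝ (s : Set E3)) ∧ affineSpan ℝ P = ⊤

/-- The faces of `P`: the empty set, and the sets of maximizers over `P` of linear functionals
(the zero functional gives `P` itself). Ordered by inclusion they form the face lattice of `P`. -/
abbrev Face (P : Set E3) : Type := {F : Set E3 // IsExposed ℝ P F}

/-- Combinatorial equivalence: the face lattices are isomorphic. -/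
def CombEquiv (P Q : Set E3) : Prop := Nonempty (Face P ≃o Face Q)

/-- The vertices of `P`. -/
def vertices (P : Set E3) : Set E3 := P.extremePoints ℝ

/-- The edges of `P`: its one-dimensional faces. -/
def IsEdge (P e : Set E3) : Prop :=
  IsExposed ℝ P e ∧ Module.finrank ℝ (vectorSpan ℝ e) = 1

/-- The facets of a 3-polytope `P`: its two-dimensional faces. -/
def IsFacet (P F : Set E3) : Prop :=
  IsExposed ℝ P F ∧ Module.finrank ℝ (vectorSpan ℝ F) = 2

/-- The segment `e` touches the unit sphere at a point `t` of `e`, and `e` lies in the tangent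
plane `{x | ⟪t, x⟫ = 1}` of the sphere at `t`. -/
def TangentToSphere (e : Set E3) : Prop :=
  ∃ t ∈ e, ‖t‖ = 1 ∧ ∀ x ∈ e, inner ℝ t x = 1

/-- `Q` is a Koebe realization of `P`. -/
def IsKoebeRealization (P Q : Set E3) : Prop :=
  IsThreePolytope Q ∧ CombEquiv P Q ∧ ∀ e : Set E3, IsEdge Q e → TangentToSphere e

/-- The subfield of `ℝ` generated over `ℚ` by the vertex coordinates of `Q`. -/
noncomputable def coordField (Q : Set E3) : IntermediateField ℚ ℝ :=
  IntermediateField.adjoin ℚ {r : ℝ | ∃ v ∈ vertices Q, ∃ i : Fin 3, r = v i}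

/-- The Koebe degree: the least degree over `ℚ` of the coordinate field of a Koebe realization
(`⊤` if all these degrees are infinite or if there is no Koebe realization). -/
noncomputable def koebeDegree (P : Set E3) : ℕ∞ :=
  ⨅ (Q : Set E3) (_ : IsKoebeRealization P Q), Cardinal.toENat (Module.rank ℚ (coordField Q))

/-- For a facet `F` of the 3-polytope `P`: the point `y` lies beyond `F`, i.e. the plane spanned
by `F` strictly separates `y` from the interior of `P`. -/
def IsBeyond (P F : Set E3) (y : E3) : Prop :=
  ∃ (l : StrongDual ℝ E3) (c : ℝ), (∀ x ∈ P, l x ≤ c) ∧ F = {x ∈ P | l x = c} ∧ c < l y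

/-- For a facet `F` of the 3-polytope `P`: the point `y` lies beneath `F`, i.e. strictly on the
same side of the plane spanned by `F` as the interior of `P`. -/
def IsBeneath (P F : Set E3) (y : E3) : Prop :=
  ∃ (l : StrongDual ℝ E3) (c : ℝ), (∀ x ∈ P, l x ≤ c) ∧ F = {x ∈ P | l x = c} ∧ l y < c

/-- Stacked 3-polytopes: start with a tetrahedron and successively stack a new vertex over a
facet, i.e. take the convex hull with a point beyond that facet and beneath all other facets. -/
inductive IsStacked : Set E3 → Prop
  | simplex (p : Fin 4 → E3) (hp : AffineIndependent ℝ p) :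
      IsStacked (convexHull ℝ (Set.range p))
  | stack (P F : Set E3) (y : E3) (hP : IsStacked P) (hF : IsFacet P F) (hy : IsBeyond P F y)
      (hG : ∀ G : Set E3, IsFacet P G → G ≠ F → IsBeneath P G y) :
      IsStacked (convexHull ℝ (insert y P))

end KoebePolytope

namespace KoebePolytope

open Set

/-! Represent a point of space by a vector `(x, 1)` up to positive scale, in ℝ⁴ with the Lorentz
form `lor`. A point outside the unit sphere can be scaled to square `2`, and two such points with
product `-2` span an edge tangent to the sphere, because their sum is a null vector orthogonal to
both. Facet planes are likewise recorded by outward normals `N`, scaled to square `8`.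

Let `T` be a triangle with vertex vectors `V a`, `V b`, `V c` and normal `N`. A vector `y = t N + V
a + V b + V c` has product `-2` with each of the three and square `8 t ^ 2 - 6`, so square `2`
forces `t = ±1`, and `t = 1` is the solution beyond `T`. The three new facet normals are `N + 2 (V b
+ V c)` and its analogues; they again have square `8`. Hence stacking uses only integer
combinations, and rationality propagates from a regular tetrahedron (`KoebeData.stack`). The
negativity conditions carried along in `KoebeData` put `y` beneath every other facet.

It remains to see that the result has the combinatorial type of `P`. `Realizes` says that a point
configuration is a simplicial polytope with a given set of triangles; this determines the face
lattice (`Realizes.faceOrderIso`) and survives stacking (`Realizes.stack`). Running `P` and its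
tangent model through the same stackings gives two realizations of one triangulation
(`IsStacked.exists_koebeData`). -/

/-! ### Affine maps, convex hulls and tetrahedra. -/

lemma affineMap_sum {ι : Type*} (f : E3 →ᵃ[ℝ] ℝ) (s : Finset ι) (w : ι → ℝ) (p : ι → E3)
    (hw : ∑ i ∈ s, w i = 1) : f (∑ i ∈ s, w i • p i) = ∑ i ∈ s, w i * f (p i) := by
  have key : ∀ x, f x = f.linear x + f 0 := fun x => by
    have := congrFun f.decomp x
    simpa using this
  rw [key, map_sum]
  have : ∀ i, w i * f (p i) = f.linear (w i • p i) + w i * f 0 := fun i => by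
    rw [key (p i), map_smul, smul_eq_mul]; ring
  simp only [this, Finset.sum_add_distrib, ← Finset.sum_mul, hw, one_mul]

/-- The affine map `l - c`. -/
noncomputable def affineOf (l : StrongDual ℝ E3) (c : ℝ) : E3 →ᵃ[ℝ] ℝ :=
  l.toLinearMap.toAffineMap - AffineMap.const ℝ E3 c

@[simp] lemma affineOf_apply (l : StrongDual ℝ E3) (c : ℝ) (x : E3) :
    affineOf l c x = l x - c := by
  simp [affineOf]

lemma convex_affine_nonpos (f : E3 →ᵃ[ℝ] ℝ) : Convex ℝ {x | f x ≤ 0} :=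
  (convex_Iic (0 : ℝ)).affine_preimage f

lemma convex_affine_eq_zero (f : E3 →ᵃ[ℝ] ℝ) : Convex ℝ {x | f x = 0} :=
  (convex_singleton (0 : ℝ)).affine_preimage f

section Weights

variable {ι : Type*} [Fintype ι]

lemma exists_weights {p : ι → E3} {x : E3} (hx : x ∈ convexHull ℝ (range p)) :
    ∃ w : ι → ℝ, (∀ i, 0 ≤ w i) ∧ ∑ i, w i = 1 ∧ ∑ i, w i • p i = x := by
  classical
  refine convexHull_min (t := {x | ∃ w : ι → ℝ, (∀ i, 0 ≤ w i) ∧ ∑ i, w i = 1 ∧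
    ∑ i, w i • p i = x}) ?_ ?_ hx
  · rintro _ ⟨v, rfl⟩
    refine ⟨fun i => if i = v then 1 else 0, fun i => ?_, by simp, by simp⟩
    dsimp only
    split_ifs <;> norm_num
  · rintro _ ⟨w, h0, h1, rfl⟩ _ ⟨w', h0', h1', rfl⟩ a b ha hb hab
    refine ⟨fun i => a * w i + b * w' i,
      fun i => add_nonneg (mul_nonneg ha (h0 i)) (mul_nonneg hb (h0' i)), ?_, ?_⟩
    · rw [Finset.sum_add_distrib, ← Finset.mul_sum, ← Finset.mul_sum, h1, h1', mul_one, mul_one,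
        hab]
    · simp only [add_smul, mul_smul, Finset.sum_add_distrib, Finset.smul_sum]

/-- A supporting affine map cuts the hull of its zero vertices out of the hull. -/
lemma convexHull_image_eq_of_nonpos {p : ι → E3} {f : E3 →ᵃ[ℝ] ℝ} {S : Finset ι}
    (hf : ∀ v, f (p v) ≤ 0) (hS : ∀ v, v ∈ S ↔ f (p v) = 0) :
    convexHull ℝ (p '' S) = {x ∈ convexHull ℝ (range p) | f x = 0} := by
  classical
  apply Subset.antisymm
  · intro x hx
    refine ⟨convexHull_mono (image_subset_range _ _) hx, ?_⟩
    refine convexHull_min ?_ (convex_affine_eq_zero f) hx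
    rintro _ ⟨v, hv, rfl⟩
    exact (hS v).1 hv
  · rintro x ⟨hx, hfx⟩
    obtain ⟨w, h0, h1, rfl⟩ := exists_weights hx
    rw [affineMap_sum f _ _ _ h1] at hfx
    have hz : ∀ v, w v * f (p v) = 0 := fun v =>
      (Finset.sum_eq_zero_iff_of_nonpos
        (fun v _ => mul_nonpos_of_nonneg_of_nonpos (h0 v) (hf v))).1 hfx v (Finset.mem_univ v)
    have hz' : ∀ v, v ∉ S → w v = 0 := fun v hv => by
      rcases mul_eq_zero.1 (hz v) with h | h
      · exact h
      · exact absurd ((hS v).2 h) hv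
    have e1 : ∑ v ∈ S, w v = 1 := by
      rw [← h1]
      exact Finset.sum_subset (Finset.subset_univ _) fun v _ hv => hz' v hv
    have e2 : ∑ v ∈ S, w v • p v = ∑ v, w v • p v :=
      Finset.sum_subset (Finset.subset_univ _) fun v _ hv => by simp [hz' v hv]
    rw [← e2]
    exact (convex_convexHull ℝ _).sum_mem (fun v _ => h0 v) e1
      fun v hv => subset_convexHull ℝ _ (mem_image_of_mem p hv)

end Weights

/-- Points with a dual family of affine maps are affinely independent. -/
lemma affineIndependent_of_dual {κ : Type*} {p : κ → E3} (h : κ → E3 →ᵃ[ℝ] ℝ)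
    (h0 : ∀ i j, i ≠ j → h i (p j) = 0) (h1 : ∀ i, h i (p i) ≠ 0) :
    AffineIndependent ℝ p := by
  classical
  rw [affineIndependent_iff]
  intro s w hw hs i hi
  have key : ∀ x, h i x = (h i).linear x + h i 0 := fun x => by
    have := congrFun (h i).decomp x
    simpa using this
  have e : ∑ j ∈ s, w j * h i (p j) = 0 := by
    have : ∀ j, w j * h i (p j) = (h i).linear (w j • p j) + w j * h i 0 := fun j => by
      rw [key (p j), map_smul, smul_eq_mul]; ring
    simp only [this, Finset.sum_add_distrib, ← Finset.sum_mul, ← map_sum, hs, hw]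
    simp
  rw [Finset.sum_eq_single_of_mem i hi (fun j _ hj => by rw [h0 i j hj.symm, mul_zero])] at e
  exact (mul_eq_zero.1 e).resolve_right (h1 i)

/-- A tetrahedron is the intersection of four half-spaces. -/
lemma mem_convexHull_of_dual {κ : Type*} [Fintype κ] (hκ : Fintype.card κ = 4) {p : κ → E3}
    (h : κ → E3 →ᵃ[ℝ] ℝ) (h0 : ∀ i j, i ≠ j → h i (p j) = 0) (h1 : ∀ i, h i (p i) < 0)
    {x : E3} (hx : ∀ i, h i x ≤ 0) : x ∈ convexHull ℝ (range p) := by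
  classical
  have hi := affineIndependent_of_dual h h0 (fun i => (h1 i).ne)
  have ht : affineSpan ℝ (range p) = ⊤ := by
    rw [hi.affineSpan_eq_top_iff_card_eq_finrank_add_one, hκ]
    simp
  let b : AffineBasis κ ℝ E3 := ⟨p, hi, ht⟩
  have e1 : ∑ i, b.coord i x = 1 := b.sum_coord_apply_eq_one x
  have e2 : ∑ i, b.coord i x • p i = x := b.linear_combination_coord_eq_self x
  -- `h i` is the `i`-th barycentric coordinate times the negative number `h i (p i)`.
  have hc : ∀ i, 0 ≤ b.coord i x := fun i => by
    have := hx i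
    rw [← e2, affineMap_sum _ _ _ _ e1, Finset.sum_eq_single i
      (fun j _ hj => by rw [h0 i j hj.symm, mul_zero]) (fun h => absurd (Finset.mem_univ i) h)]
      at this
    nlinarith [h1 i]
  rw [← e2]
  exact (convex_convexHull ℝ _).sum_mem (fun v _ => hc v) e1
    fun v _ => subset_convexHull ℝ _ (mem_range_self v)

/-! ### Simplicial polytopes and their face lattices. -/

/-- `f` vanishes at the points indexed by `T` and is negative at all other points of `p`. -/
def Supports {ι : Type*} (p : ι → E3) (T : Finset ι) (f : E3 →ᵃ[ℝ] ℝ) : Prop :=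
  (∀ v ∈ T, f (p v) = 0) ∧ ∀ v, v ∉ T → f (p v) < 0

lemma Supports.nonpos {ι : Type*} {p : ι → E3} {T : Finset ι} {f : E3 →ᵃ[ℝ] ℝ}
    (h : Supports p T f) (v : ι) : f (p v) ≤ 0 := by
  by_cases hv : v ∈ T
  · exact (h.1 v hv).le
  · exact (h.2 v hv).le

lemma Supports.mem_iff {ι : Type*} {p : ι → E3} {T : Finset ι} {f : E3 →ᵃ[ℝ] ℝ}
    (h : Supports p T f) (v : ι) : v ∈ T ↔ f (p v) = 0 :=
  ⟨h.1 v, fun h0 => by_contra fun hv => (h.2 v hv).ne h0⟩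

/-- A set of triangles such that across each side of a triangle there is another triangle. -/
structure IsTriangulation {ι : Type*} [DecidableEq ι] (𝓕 : Set (Finset ι)) : Prop where
  nonempty : 𝓕.Nonempty
  card : ∀ T ∈ 𝓕, T.card = 3
  adj : ∀ T ∈ 𝓕, ∀ v ∈ T, ∃ T' ∈ 𝓕, v ∉ T' ∧ T.erase v ⊆ T'

/-- The convex hull of the points `p` is a simplicial polytope with facets indexed by `𝓕`. -/
structure Realizes {ι : Type*} (p : ι → E3) (𝓕 : Set (Finset ι)) : Prop where
  supp : ∀ T ∈ 𝓕, ∃ f, Supports p T f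
  complete : ∀ x, (∀ T ∈ 𝓕, ∃ f, Supports p T f ∧ f x ≤ 0) → x ∈ convexHull ℝ (range p)

namespace Realizes

set_option linter.unusedSectionVars false

variable {ι : Type*} [Fintype ι] [DecidableEq ι] {p : ι → E3} {𝓕 : Set (Finset ι)}

/-- Vertices are removed from `T` one at a time: to drop `a`, add a supporting map of the triangle
across the side opposite `a`, which still vanishes on the rest of `T` but is negative at `a`. -/
lemma exists_supports (hp : Realizes p 𝓕) (h𝓕 : IsTriangulation 𝓕) {T S : Finset ι}
    (hT : T ∈ 𝓕) (hS : S ⊆ T) : ∃ f, Supports p S f := by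
  have key : ∀ U : Finset ι, U ⊆ T → ∃ f, Supports p (T \ U) f := by
    intro U
    induction U using Finset.induction_on with
    | empty => intro _; simpa using hp.supp T hT
    | insert a U ha ih =>
      intro hU
      obtain ⟨f, hf⟩ := ih ((Finset.subset_insert a U).trans hU)
      have haT : a ∈ T := hU (Finset.mem_insert_self a U)
      obtain ⟨T', hT', haT', hs⟩ := h𝓕.adj T hT a haT
      obtain ⟨g, hg⟩ := hp.supp T' hT'
      refine ⟨f + g, fun v hv => ?_, fun v hv => ?_⟩
      · simp only [Finset.mem_sdiff, Finset.mem_insert, not_or] at hv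
        simp [hf.1 v (by simp [hv]), hg.1 v (hs (by simp [hv]))]
      · have h1 := hf.nonpos v
        have h2 := hg.nonpos v
        simp only [AffineMap.coe_add, Pi.add_apply]
        by_cases hva : v = a
        · subst hva
          linarith [hg.2 v haT']
        · have := hf.2 v (by simp_all)
          linarith
  have := key (T \ S) Finset.sdiff_subset
  rwa [Finset.sdiff_sdiff_eq_self hS] at this

lemma affineIndependent (hp : Realizes p 𝓕) (h𝓕 : IsTriangulation 𝓕) {T : Finset ι}
    (hT : T ∈ 𝓕) : AffineIndependent ℝ (fun v : T => p v) := by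
  choose h hh using fun v : T => hp.exists_supports h𝓕 hT (Finset.erase_subset v.1 T)
  refine affineIndependent_of_dual h (fun i j hij => ?_) fun i => ?_
  · exact (hh i).1 j (by simp [Subtype.val_injective.ne hij.symm])
  · exact ((hh i).2 i (by simp)).ne

lemma finrank_vectorSpan (hp : Realizes p 𝓕) (h𝓕 : IsTriangulation 𝓕) {T : Finset ι}
    (hT : T ∈ 𝓕) : Module.finrank ℝ (vectorSpan ℝ (convexHull ℝ (p '' T))) = 2 := by
  rw [← direction_affineSpan, affineSpan_convexHull, direction_affineSpan]
  have := (hp.affineIndependent h𝓕 hT).finrank_vectorSpan (n := 2) (by simp [h𝓕.card T hT])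
  rwa [show range (fun v : T => p v) = p '' T by ext; simp] at this

lemma finrank_vectorSpan_le (p : ι → E3) {S : Finset ι} {n : ℕ} (hS : S.card ≤ n + 1) :
    Module.finrank ℝ (vectorSpan ℝ (convexHull ℝ (p '' S))) ≤ n := by
  rw [← direction_affineSpan, affineSpan_convexHull, direction_affineSpan]
  rcases S.eq_empty_or_nonempty with rfl | hne
  · have h0 : vectorSpan ℝ (p '' ((∅ : Finset ι) : Set ι)) = ⊥ := by simp
    rw [h0, finrank_bot]
    exact n.zero_le
  · have h1 := finrank_vectorSpan_image_finset_le ℝ p S (n := S.card - 1)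
      (by have := hne.card_pos; omega)
    rw [Finset.coe_image] at h1
    omega

lemma exists_notMem (h𝓕 : IsTriangulation 𝓕) {T : Finset ι} (hT : T ∈ 𝓕) : ∃ v, v ∉ T := by
  have hc := h𝓕.card T hT
  obtain ⟨a, ha⟩ := Finset.card_pos.1 (by omega : 0 < T.card)
  obtain ⟨T', hT', haT', -⟩ := h𝓕.adj T hT a ha
  by_contra! hall
  have hss : T' ⊂ T := ⟨fun v _ => hall v, fun h => haT' (h ha)⟩
  have := Finset.card_lt_card hss
  rw [hc, h𝓕.card T' hT'] at this
  omega

/-- The barycentre of points not all lying on a common facet is interior. -/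
lemma barycentre_mem_interior (hp : Realizes p 𝓕) {S : Finset ι} (hne : S.Nonempty)
    (hS : ∀ T ∈ 𝓕, ¬ S ⊆ T) :
    ∑ v ∈ S, ((S.card : ℝ)⁻¹) • p v ∈ interior (convexHull ℝ (range p)) := by
  have hpos : 0 < (S.card : ℝ)⁻¹ := inv_pos.2 (Nat.cast_pos.2 hne.card_pos)
  have h1 : ∑ v ∈ S, (S.card : ℝ)⁻¹ = 1 := by
    rw [Finset.sum_const, nsmul_eq_mul, mul_inv_cancel₀]
    exact (Nat.cast_pos.2 hne.card_pos).ne'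
  choose! f hf using hp.supp
  -- The open half-spaces of the finitely many facets meet in an open subset of the hull; each facet
  -- misses some point of `S`, which makes its map strictly negative at the barycentre.
  refine mem_interior.2 ⟨⋂ T ∈ 𝓕, {x | f T x < 0}, ?_, ?_, ?_⟩
  · intro x hx
    simp only [mem_iInter] at hx
    exact hp.complete x fun T hT => ⟨f T, hf T hT, (hx T hT).le⟩
  · exact (Set.toFinite 𝓕).isOpen_biInter fun T _ =>
      isOpen_lt (f T).continuous_of_finiteDimensional continuous_const
  · simp only [mem_iInter]
    intro T hT
    obtain ⟨a, ha, haT⟩ := Finset.not_subset.1 (hS T hT)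
    rw [mem_ofPred_eq, affineMap_sum _ _ _ _ h1]
    exact Finset.sum_neg' (fun v _ => mul_nonpos_of_nonneg_of_nonpos hpos.le ((hf T hT).nonpos v))
      ⟨a, ha, mul_neg_of_pos_of_neg hpos ((hf T hT).2 a haT)⟩

lemma affineSpan_eq_top (hp : Realizes p 𝓕) (h𝓕 : IsTriangulation 𝓕) :
    affineSpan ℝ (convexHull ℝ (range p)) = ⊤ := by
  obtain ⟨T, hT⟩ := h𝓕.nonempty
  obtain ⟨v, hv⟩ := exists_notMem h𝓕 hT
  have := hp.barycentre_mem_interior (S := Finset.univ) ⟨v, Finset.mem_univ v⟩ fun T' hT' hs => by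
    obtain ⟨w, hw⟩ := exists_notMem h𝓕 hT'
    exact hw (hs (Finset.mem_univ w))
  rw [affineSpan_convexHull, ← interior_convexHull_nonempty_iff_affineSpan_eq_top]
  exact ⟨_, this⟩

lemma isThreePolytope (hp : Realizes p 𝓕) (h𝓕 : IsTriangulation 𝓕) :
    IsThreePolytope (convexHull ℝ (range p)) :=
  ⟨⟨Finset.univ.image p, by simp⟩, hp.affineSpan_eq_top h𝓕⟩

lemma finrank_vectorSpan_self (hp : Realizes p 𝓕) (h𝓕 : IsTriangulation 𝓕) :
    Module.finrank ℝ (vectorSpan ℝ (convexHull ℝ (range p))) = 3 := by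
  rw [← direction_affineSpan, hp.affineSpan_eq_top h𝓕, AffineSubspace.direction_top, finrank_top]
  simp

lemma mem_convexHull_image_iff {S : Finset ι} {f : E3 →ᵃ[ℝ] ℝ} (hf : Supports p S f) (v : ι) :
    p v ∈ convexHull ℝ (p '' S) ↔ v ∈ S := by
  rw [convexHull_image_eq_of_nonpos hf.nonpos hf.mem_iff, hf.mem_iff]
  exact ⟨fun h => h.2, fun h => ⟨subset_convexHull ℝ _ (mem_range_self v), h⟩⟩

lemma isExposed_of_supports {S : Finset ι} {f : E3 →ᵃ[ℝ] ℝ} (hf : Supports p S f) :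
    IsExposed ℝ (convexHull ℝ (range p)) (convexHull ℝ (p '' S)) := by
  rintro ⟨x₀, hx₀⟩
  have key : ∀ x, f x = f.linear x + f 0 := fun x => by
    have := congrFun f.decomp x
    simpa using this
  rw [convexHull_image_eq_of_nonpos hf.nonpos hf.mem_iff] at hx₀ ⊢
  have hle : ∀ x ∈ convexHull ℝ (range p), f x ≤ 0 := fun x hx =>
    convexHull_min (range_subset_iff.2 hf.nonpos) (convex_affine_nonpos f) hx
  refine ⟨LinearMap.toContinuousLinearMap f.linear, ?_⟩
  ext x
  simp only [mem_ofPred_eq, LinearMap.coe_toContinuousLinearMap', and_congr_right_iff]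
  intro hx
  constructor
  · intro h0 y hy
    linarith [hle y hy, key x, key y]
  · intro h
    linarith [h x₀ hx₀.1, key x, key x₀, hx₀.2, hle x hx]

/-- Every nonempty proper face is spanned by vertices of a common triangle. -/
lemma exists_eq_convexHull (hp : Realizes p 𝓕) (h𝓕 : IsTriangulation 𝓕) {G : Set E3}
    (hG : IsExposed ℝ (convexHull ℝ (range p)) G) :
    ∃ S : Finset ι, (S = Finset.univ ∨ ∃ T ∈ 𝓕, S ⊆ T) ∧ G = convexHull ℝ (p '' S) := by
  classical
  -- The empty face is exposed by convention, without any functional; it is spanned by no vertices.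
  rcases G.eq_empty_or_nonempty with rfl | hne
  · obtain ⟨T, hT⟩ := h𝓕.nonempty
    exact ⟨∅, Or.inr ⟨T, hT, by simp⟩, by simp⟩
  obtain ⟨l, hl⟩ := hG hne
  obtain ⟨x₀, hx₀⟩ := id hne
  rw [hl] at hx₀
  let f := affineOf l (l x₀)
  have hfle : ∀ x ∈ convexHull ℝ (range p), f x ≤ 0 := fun x hx => by
    simpa [f] using hx₀.2 x hx
  let S : Finset ι := Finset.univ.filter fun v => f (p v) = 0
  have hGS : G = convexHull ℝ (p '' S) := by
    rw [convexHull_image_eq_of_nonpos (f := f)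
      (fun v => hfle _ (subset_convexHull ℝ _ (mem_range_self v))) (by simp [S]), hl]
    ext x
    simp only [mem_ofPred_eq, and_congr_right_iff]
    intro hx
    constructor
    · intro h
      have := h x₀ hx₀.1
      have := hx₀.2 x hx
      simp only [f, affineOf_apply]; linarith
    · intro h y hy
      have := hx₀.2 y hy
      simp only [f, affineOf_apply] at h; linarith
  refine ⟨S, ?_, hGS⟩
  by_contra! hcon
  obtain ⟨hSu, hST⟩ := hcon
  have hSne : S.Nonempty := by
    rw [hGS, convexHull_nonempty_iff] at hne
    simpa using hne
  have hint := hp.barycentre_mem_interior hSne hST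
  set x := ∑ v ∈ S, ((S.card : ℝ)⁻¹) • p v with hxdef
  have hfx : f x = 0 := by
    rw [hxdef, affineMap_sum]
    · refine Finset.sum_eq_zero fun v hv => ?_
      rw [(Finset.mem_filter.1 hv).2, mul_zero]
    · rw [Finset.sum_const, nsmul_eq_mul, mul_inv_cancel₀]
      exact (Nat.cast_pos.2 hSne.card_pos).ne'
  obtain ⟨w, hw⟩ : ∃ w, w ∉ S := by
    by_contra! h
    exact hSu (Finset.eq_univ_iff_forall.2 h)
  have hfw : f (p w) < 0 := lt_of_le_of_ne
    (hfle _ (subset_convexHull ℝ _ (mem_range_self w))) (by simpa [S] using hw)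
  have hcont : ContinuousAt (fun ε : ℝ => AffineMap.lineMap x (p w) ε) 0 :=
    AffineMap.lineMap_continuous.continuousAt
  have hev : ∀ᶠ ε : ℝ in nhds 0, AffineMap.lineMap x (p w) ε ∈ convexHull ℝ (range p) :=
    hcont.eventually (by
      simp only [AffineMap.lineMap_apply_zero]
      exact mem_interior_iff_mem_nhds.1 hint)
  obtain ⟨δ, hδ, hball⟩ := Metric.eventually_nhds_iff.1 hev
  -- If `S` lay in no triangle, its barycentre `x` would be interior with `f x = 0`. A negative
  -- parameter moves from `x` away from `p w`, so that `f` becomes positive inside the hull, a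
  -- contradiction.
  have hmem := hball (y := -(δ / 2)) (by
    rw [Real.dist_eq, sub_zero, abs_neg, abs_of_pos (by linarith)]; linarith)
  have := hfle _ hmem
  rw [AffineMap.apply_lineMap, hfx, AffineMap.lineMap_apply_module] at this
  simp only [smul_eq_mul] at this
  nlinarith

/-- The face lattice is determined by the triangles. -/
noncomputable def faceOrderIso (hp : Realizes p 𝓕) (h𝓕 : IsTriangulation 𝓕) :
    {S : Finset ι // S = Finset.univ ∨ ∃ T ∈ 𝓕, S ⊆ T} ≃o Face (convexHull ℝ (range p)) :=
  have hs : ∀ S : Finset ι, (S = Finset.univ ∨ ∃ T ∈ 𝓕, S ⊆ T) → ∃ f, Supports p S f := by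
    rintro S (rfl | ⟨T, hT, hS⟩)
    · exact ⟨0, by simp [Supports]⟩
    · exact hp.exists_supports h𝓕 hT hS
  RelIso.ofSurjective
    (OrderEmbedding.ofMapLEIff
      (fun S => ⟨convexHull ℝ (p '' S.1), isExposed_of_supports (hs S.1 S.2).choose_spec⟩)
      (fun S S' => by
        change convexHull ℝ (p '' S.1) ⊆ convexHull ℝ (p '' S'.1) ↔ S.1 ⊆ S'.1
        refine ⟨fun h v hv => ?_, fun h => convexHull_mono (image_mono (by simpa using h))⟩
        rw [← mem_convexHull_image_iff (hs S'.1 S'.2).choose_spec]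
        exact h (subset_convexHull ℝ _ (mem_image_of_mem p hv))))
    (fun G => by
      obtain ⟨S, hS, hG⟩ := hp.exists_eq_convexHull h𝓕 G.2
      exact ⟨⟨S, hS⟩, Subtype.ext hG.symm⟩)

lemma isFacet (hp : Realizes p 𝓕) (h𝓕 : IsTriangulation 𝓕) {T : Finset ι} (hT : T ∈ 𝓕) :
    IsFacet (convexHull ℝ (range p)) (convexHull ℝ (p '' T)) := by
  obtain ⟨f, hf⟩ := hp.supp T hT
  exact ⟨isExposed_of_supports hf, hp.finrank_vectorSpan h𝓕 hT⟩

lemma exists_of_isFacet (hp : Realizes p 𝓕) (h𝓕 : IsTriangulation 𝓕) {F : Set E3}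
    (hF : IsFacet (convexHull ℝ (range p)) F) : ∃ T ∈ 𝓕, F = convexHull ℝ (p '' T) := by
  obtain ⟨hF, hr⟩ := hF
  obtain ⟨S, rfl | ⟨T, hT, hS⟩, rfl⟩ := hp.exists_eq_convexHull h𝓕 hF
  · have := hp.finrank_vectorSpan_self h𝓕
    rw [Finset.coe_univ, image_univ] at hr
    omega
  · have hc : ¬ S.card ≤ 1 + 1 := fun h => by
      have := finrank_vectorSpan_le p h
      omega
    have : S = T := Finset.eq_of_subset_of_card_le hS (by rw [h𝓕.card T hT]; omega)
    exact ⟨T, hT, by rw [this]⟩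

lemma exists_of_isEdge (hp : Realizes p 𝓕) (h𝓕 : IsTriangulation 𝓕) {e : Set E3}
    (he : IsEdge (convexHull ℝ (range p)) e) :
    ∃ T ∈ 𝓕, ∃ u ∈ T, ∃ v ∈ T, u ≠ v ∧ e = segment ℝ (p u) (p v) := by
  obtain ⟨he, hr⟩ := he
  obtain ⟨S, rfl | ⟨T, hT, hS⟩, rfl⟩ := hp.exists_eq_convexHull h𝓕 he
  · have := hp.finrank_vectorSpan_self h𝓕
    rw [Finset.coe_univ, image_univ] at hr
    omega
  · have h1 : ¬ S.card ≤ 0 + 1 := fun h => by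
      have := finrank_vectorSpan_le p h
      omega
    have h2 : S.card ≠ 3 := fun h => by
      have : S = T := Finset.eq_of_subset_of_card_le hS (by rw [h𝓕.card T hT, h])
      have := hp.finrank_vectorSpan h𝓕 (this ▸ hT)
      omega
    have h3 := Finset.card_le_card hS
    rw [h𝓕.card T hT] at h3
    obtain ⟨u, v, huv, rfl⟩ := Finset.card_eq_two.1 (by omega : S.card = 2)
    refine ⟨T, hT, u, hS (by simp), v, hS (by simp), huv, ?_⟩
    rw [← convexHull_pair]
    simp [image_pair]

/-- This turns the functionals of `IsBeyond` and `IsBeneath` into supporting maps of triangles. -/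
lemma supports_of_facet_eq {T : Finset ι} (hT : ∃ f, Supports p T f) {l : StrongDual ℝ E3} {c : ℝ}
    (hl : ∀ x ∈ convexHull ℝ (range p), l x ≤ c)
    (he : convexHull ℝ (p '' T) = {x ∈ convexHull ℝ (range p) | l x = c}) :
    Supports p T (affineOf l c) := by
  obtain ⟨f, hf⟩ := hT
  have hm : ∀ v, p v ∈ convexHull ℝ (range p) := fun v => subset_convexHull ℝ _ (mem_range_self v)
  have key : ∀ v, v ∈ T ↔ l (p v) = c := fun v => by
    rw [← mem_convexHull_image_iff hf, he]
    exact ⟨fun h => h.2, fun h => ⟨hm v, h⟩⟩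
  refine ⟨fun v hv => ?_, fun v hv => ?_⟩
  · simp [(key v).1 hv]
  · have := lt_of_le_of_ne (hl _ (hm v)) fun h => hv ((key v).2 h)
    simpa using this

end Realizes

/-! ### Stacking on triangulations and on realizations. -/

section Stacking

variable {ι : Type*}

/-- The points `p` together with the new point `y`. -/
def addPoint {α : Type*} (p : ι → α) (y : α) : Option ι → α := fun o => o.elim y p

@[simp] lemma addPoint_none {α : Type*} (p : ι → α) (y : α) : addPoint p y none = y := rfl

@[simp] lemma addPoint_some {α : Type*} (p : ι → α) (y : α) (v : ι) :
    addPoint p y (some v) = p v := rfl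

lemma range_addPoint {α : Type*} (p : ι → α) (y : α) :
    range (addPoint p y) = insert y (range p) := by
  ext x
  simp [Option.exists, eq_comm]

lemma Supports.of_addPoint {p : ι → E3} {y : E3} {S : Finset ι} {f : E3 →ᵃ[ℝ] ℝ}
    (h : Supports (addPoint p y) (S.map Function.Embedding.some) f) : Supports p S f :=
  ⟨fun v hv => h.1 (some v) (by simpa using hv), fun v hv => h.2 (some v) (by simpa using hv)⟩

variable [DecidableEq ι]

/-- Replace the triangle `T` by the three triangles joining its sides to a new vertex `none`. -/
def stackTriangles (𝓕 : Set (Finset ι)) (T : Finset ι) : Set (Finset (Option ι)) :=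
  {U | (∃ S ∈ 𝓕, S ≠ T ∧ U = S.map Function.Embedding.some) ∨
    ∃ v ∈ T, U = Finset.insertNone (T.erase v)}

variable {𝓕 : Set (Finset ι)} {T : Finset ι}

lemma IsTriangulation.stack (h𝓕 : IsTriangulation 𝓕) (hT : T ∈ 𝓕) :
    IsTriangulation (stackTriangles 𝓕 T) := by
  have hc := h𝓕.card T hT
  refine ⟨?_, ?_, ?_⟩
  · obtain ⟨a, ha⟩ := Finset.card_pos.1 (by omega : 0 < T.card)
    exact ⟨_, Or.inr ⟨a, ha, rfl⟩⟩
  · rintro _ (⟨S, hS, -, rfl⟩ | ⟨a, ha, rfl⟩)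
    · rw [Finset.card_map, h𝓕.card S hS]
    · rw [Finset.card_insertNone, Finset.card_erase_of_mem ha, hc]
  · rintro _ (⟨S, hS, hST, rfl⟩ | ⟨a, ha, rfl⟩) w hw
    · obtain ⟨v, hv, rfl⟩ := Finset.mem_map.1 hw
      obtain ⟨S', hS', hvS', hsub⟩ := h𝓕.adj S hS v hv
      -- If the neighbour was the removed triangle `T`, the new triangle on the common side replaces
      -- it.
      by_cases hS'T : S' = T
      · subst hS'T
        obtain ⟨a, ha, haS⟩ : ∃ a ∈ S', a ∉ S := by
          by_contra! h
          exact hST (Finset.eq_of_subset_of_card_le h (by rw [h𝓕.card S hS, hc])).symm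
        refine ⟨_, Or.inr ⟨a, ha, rfl⟩, by simp [hvS'], ?_⟩
        rintro (_ | u) hu
        · simp
        · have hu' : u ≠ v ∧ u ∈ S := by simpa using hu
          simp only [Finset.some_mem_insertNone, Finset.mem_erase]
          exact ⟨fun h => haS (h ▸ hu'.2), hsub (by simp [hu'])⟩
      · refine ⟨_, Or.inl ⟨S', hS', hS'T, rfl⟩, by simpa using hvS', ?_⟩
        rintro (_ | u) hu
        · simp at hu
        · have : u ≠ v ∧ u ∈ S := by simpa using hu
          simpa using hsub (by simp [this])
    · rcases w with _ | b
      · obtain ⟨S', hS', haS', hsub⟩ := h𝓕.adj T hT a ha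
        refine ⟨_, Or.inl ⟨S', hS', fun h => haS' (h ▸ ha), rfl⟩, by simp, ?_⟩
        rintro (_ | u) hu
        · simp at hu
        · simpa using hsub (by simpa using hu)
      · have hb : b ≠ a ∧ b ∈ T := by simpa using hw
        refine ⟨_, Or.inr ⟨b, hb.2, rfl⟩, by simp, ?_⟩
        rintro (_ | u) hu
        · simp
        · have : u ≠ b ∧ u ≠ a ∧ u ∈ T := by simpa using hu
          simp [this]

/-- Stacking a point beyond `T` and beneath all other triangles. -/
lemma Realizes.stack {p : ι → E3} (hp : Realizes p 𝓕) (h𝓕 : IsTriangulation 𝓕) (hT : T ∈ 𝓕)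
    {y : E3} (hbeyond : ∃ f, Supports p T f ∧ 0 < f y)
    (hbeneath : ∀ S ∈ 𝓕, S ≠ T → ∃ f, Supports p S f ∧ f y < 0) :
    Realizes (addPoint p y) (stackTriangles 𝓕 T) := by
  obtain ⟨f, hf, hfy⟩ := hbeyond
  constructor
  · rintro _ (⟨S, hS, hST, rfl⟩ | ⟨a, ha, rfl⟩)
    · obtain ⟨g, hg, hgy⟩ := hbeneath S hS hST
      refine ⟨g, ?_, ?_⟩
      · rintro (_ | v) hv
        · simp at hv
        · exact hg.1 v (by simpa using hv)
      · rintro (_ | v) hv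
        · exact hgy
        · exact hg.2 v (by simpa using hv)
    · obtain ⟨S, hS, haS, hsub⟩ := h𝓕.adj T hT a ha
      obtain ⟨g, hg, hgy⟩ := hbeneath S hS fun h => haS (h ▸ ha)
      -- In the pencil of planes through the side shared with `S`, this is the one through `y`; both
      -- coefficients are positive, which preserves the signs at old vertices.
      refine ⟨(-g y) • f + f y • g, ?_, ?_⟩
      · rintro (_ | v) hv
        · simp; ring
        · have hv' : v ≠ a ∧ v ∈ T := by simpa using hv
          simp [hf.1 v hv'.2, hg.1 v (hsub (by simp [hv']))]
      · rintro (_ | v) hv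
        · simp at hv
        · simp only [AffineMap.coe_add, AffineMap.coe_smul, Pi.add_apply, Pi.smul_apply,
            addPoint_some, smul_eq_mul]
          by_cases hvT : v ∈ T
          · have hva : v = a := by
              by_contra h
              exact hv (by simp [h, hvT])
            subst hva
            rw [hf.1 v hvT, mul_zero, zero_add]
            exact mul_neg_of_pos_of_neg hfy (hg.2 v haS)
          · have h1 := mul_neg_of_pos_of_neg (neg_pos.2 hgy) (hf.2 v hvT)
            have h2 := mul_nonpos_of_nonneg_of_nonpos hfy.le (hg.nonpos v)
            linarith
  · intro x hx
    -- A point beneath `T` lies in the old polytope; a point beyond `T` lies in the tetrahedron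
    -- spanned by `T` and `y`.
    by_cases hfx : f x ≤ 0
    · refine convexHull_mono ?_ (hp.complete x fun S hS => ?_)
      · rw [range_addPoint]
        exact subset_insert _ _
      · by_cases hST : S = T
        · subst hST
          exact ⟨f, hf, hfx⟩
        · obtain ⟨g, hg, hgx⟩ := hx _ (Or.inl ⟨S, hS, hST, rfl⟩)
          exact ⟨g, hg.of_addPoint, hgx⟩
    · choose g hg hgx using fun a : T => hx _ (Or.inr ⟨a.1, a.2, rfl⟩)
      have hmem : x ∈ convexHull ℝ (range fun o : Option T => o.elim y fun v => p v) := by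
        refine mem_convexHull_of_dual (by simp [h𝓕.card T hT])
          (fun o => o.elim (-f) g) ?_ ?_ ?_
        · rintro (_ | u) (_ | v) huv
          · exact absurd rfl huv
          · simp [hf.1 v v.2]
          · exact (hg u).1 none (by simp)
          · have : (v : ι) ≠ u := fun h => huv (by rw [Subtype.ext h])
            exact (hg u).1 (some v) (by simp [this])
        · rintro (_ | u)
          · simpa using hfy
          · exact (hg u).2 (some u) (by simp)
        · rintro (_ | u)
          · simp only [Option.elim_none, AffineMap.coe_neg, Pi.neg_apply]
            linarith
          · exact hgx u
      refine convexHull_mono ?_ hmem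
      rintro _ ⟨_ | v, rfl⟩
      · exact ⟨none, rfl⟩
      · exact ⟨some v, rfl⟩

end Stacking

/-! ### The tetrahedron as a realization. -/

/-- The triangles of a tetrahedron. -/
def tetrahedronTriangles : Set (Finset (Fin 4)) := range fun i => Finset.univ.erase i

lemma isTriangulation_tetrahedron : IsTriangulation tetrahedronTriangles := by
  refine ⟨range_nonempty _, ?_, ?_⟩
  · rintro _ ⟨i, rfl⟩
    simp
  · rintro _ ⟨i, rfl⟩ v hv
    exact ⟨_, ⟨v, rfl⟩, by simp, Finset.erase_subset_erase _ (Finset.erase_subset _ _)⟩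

lemma realizes_tetrahedron {p : Fin 4 → E3} (hp : AffineIndependent ℝ p) :
    Realizes p tetrahedronTriangles := by
  have ht : affineSpan ℝ (range p) = ⊤ := by
    rw [hp.affineSpan_eq_top_iff_card_eq_finrank_add_one]
    simp
  let b : AffineBasis (Fin 4) ℝ E3 := ⟨p, hp, ht⟩
  constructor
  · rintro _ ⟨i, rfl⟩
    refine ⟨-b.coord i, fun v hv => ?_, fun v hv => ?_⟩
    · have h : i ≠ v := by simpa [eq_comm] using hv
      have := b.coord_apply_ne h
      change -(b.coord i) (b v) = 0
      rw [this, neg_zero]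
    · have h : v = i := by simpa using hv
      subst h
      have := b.coord_apply_eq v
      change -(b.coord v) (b v) < 0
      rw [this]; norm_num
  · intro x hx
    choose h hh hx using fun i => hx _ ⟨i, rfl⟩
    refine mem_convexHull_of_dual (by simp) h (fun i j hij => ?_) (fun i => ?_) hx
    · exact (hh i).1 j (by simp [hij.symm])
    · exact (hh i).2 i (by simp)

/-! ### The Lorentz form and tangency of edges. -/

/-- The Lorentz form on rational vectors. -/
def lor (A B : Fin 4 → ℚ) : ℚ := A 0 * B 0 + A 1 * B 1 + A 2 * B 2 - A 3 * B 3

lemma lor_comm (A B : Fin 4 → ℚ) : lor A B = lor B A := by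
  simp only [lor]; ring

lemma lor_add_left (A B C : Fin 4 → ℚ) : lor (A + B) C = lor A C + lor B C := by
  simp only [lor, Pi.add_apply]; ring

lemma lor_add_right (A B C : Fin 4 → ℚ) : lor A (B + C) = lor A B + lor A C := by
  simp only [lor, Pi.add_apply]; ring

lemma lor_smul_left (r : ℚ) (A B : Fin 4 → ℚ) : lor (r • A) B = r * lor A B := by
  simp only [lor, Pi.smul_apply, smul_eq_mul]; ring

lemma lor_smul_right (r : ℚ) (A B : Fin 4 → ℚ) : lor A (r • B) = r * lor A B := by
  simp only [lor, Pi.smul_apply, smul_eq_mul]; ring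

/-- The point of `ℝ³` with the given homogeneous coordinates. -/
noncomputable def toPoint (A : Fin 4 → ℚ) : E3 :=
  !₂[((A 0 / A 3 : ℚ) : ℝ), ((A 1 / A 3 : ℚ) : ℝ), ((A 2 / A 3 : ℚ) : ℝ)]

lemma toPoint_rational (A : Fin 4 → ℚ) (i : Fin 3) : ∃ q : ℚ, toPoint A i = (q : ℝ) := by
  fin_cases i
  · exact ⟨_, rfl⟩
  · exact ⟨_, rfl⟩
  · exact ⟨_, rfl⟩

/-- The affine map `x ↦ ⟨N, (x, 1)⟩` for the Lorentz form. -/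
noncomputable def lorAffine (N : Fin 4 → ℚ) : E3 →ᵃ[ℝ] ℝ :=
  affineOf (innerSL ℝ (!₂[(N 0 : ℝ), (N 1 : ℝ), (N 2 : ℝ)] : E3)) (N 3 : ℝ)

lemma lorAffine_toPoint (N A : Fin 4 → ℚ) (hA : 0 < A 3) :
    lorAffine N (toPoint A) = ((lor N A / A 3 : ℚ) : ℝ) := by
  have h : (A 3 : ℝ) ≠ 0 := by exact_mod_cast hA.ne'
  simp only [lorAffine, affineOf_apply, innerSL_apply_apply, PiLp.inner_apply, toPoint,
    Fin.sum_univ_three, lor]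
  simp
  field_simp

lemma lorAffine_toPoint_neg {N A : Fin 4 → ℚ} (hA : 0 < A 3) (h : lor N A < 0) :
    lorAffine N (toPoint A) < 0 := by
  rw [lorAffine_toPoint N A hA]
  exact_mod_cast div_neg_of_neg_of_pos h hA

lemma lorAffine_toPoint_pos {N A : Fin 4 → ℚ} (hA : 0 < A 3) (h : 0 < lor N A) :
    0 < lorAffine N (toPoint A) := by
  rw [lorAffine_toPoint N A hA]
  exact_mod_cast div_pos h hA

lemma lorAffine_toPoint_eq_zero {N A : Fin 4 → ℚ} (hA : 0 < A 3) (h : lor N A = 0) :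
    lorAffine N (toPoint A) = 0 := by
  rw [lorAffine_toPoint N A hA, h]
  simp

/-- Since `2 - 4 + 2 = 0` and `2 - 2 = 0`, the vector `A + B` is null and orthogonal to `A` and `B`.
Its point is therefore on the sphere, and the tangent plane there contains the segment. -/
lemma tangentToSphere_segment {A B : Fin 4 → ℚ} (hA : 0 < A 3) (hB : 0 < B 3)
    (hAA : lor A A = 2) (hBB : lor B B = 2) (hAB : lor A B = -2) :
    TangentToSphere (segment ℝ (toPoint A) (toPoint B)) := by
  have hA' : (0 : ℝ) < A 3 := by exact_mod_cast hA
  have hB' : (0 : ℝ) < B 3 := by exact_mod_cast hB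
  have hAA' : (A 0 * A 0 + A 1 * A 1 + A 2 * A 2 - A 3 * A 3 : ℝ) = 2 := by exact_mod_cast hAA
  have hBB' : (B 0 * B 0 + B 1 * B 1 + B 2 * B 2 - B 3 * B 3 : ℝ) = 2 := by exact_mod_cast hBB
  have hAB' : (A 0 * B 0 + A 1 * B 1 + A 2 * B 2 - A 3 * B 3 : ℝ) = -2 := by exact_mod_cast hAB
  have hs : (A 3 + B 3 : ℝ) ≠ 0 := (add_pos hA' hB').ne'
  -- These weights give the point with homogeneous coordinates `A + B`.
  set t : E3 := (A 3 / (A 3 + B 3) : ℝ) • toPoint A + (B 3 / (A 3 + B 3) : ℝ) • toPoint B with ht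
  have tc : ∀ x : E3, inner ℝ t x =
      ((A 0 + B 0) * x 0 + (A 1 + B 1) * x 1 + (A 2 + B 2) * x 2) / (A 3 + B 3) := fun x => by
    simp only [ht, PiLp.inner_apply, toPoint, Fin.sum_univ_three]
    simp
    field_simp
  have h1 : inner ℝ t (toPoint A) = 1 := by
    rw [tc, div_eq_one_iff_eq hs]
    simp [toPoint]
    field_simp
    linarith
  have h2 : inner ℝ t (toPoint B) = 1 := by
    rw [tc, div_eq_one_iff_eq hs]
    simp [toPoint]
    field_simp
    linarith
  have hmem : t ∈ segment ℝ (toPoint A) (toPoint B) :=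
    ⟨_, _, by positivity, by positivity, by field_simp, ht.symm⟩
  have hx : ∀ x ∈ segment ℝ (toPoint A) (toPoint B), inner ℝ t x = 1 := by
    rintro _ ⟨a, b, -, -, hab, rfl⟩
    rw [inner_add_right, inner_smul_right, inner_smul_right, h1, h2]
    linarith
  refine ⟨t, hmem, ?_, hx⟩
  have := hx t hmem
  rw [real_inner_self_eq_norm_sq] at this
  exact (pow_eq_one_iff_of_nonneg (norm_nonneg t) two_ne_zero).1 this

/-! ### Rational edge-tangent data and their stacking. -/

/-- Vertex vectors `V` and facet vectors `N` of a rational edge-tangent realization. -/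
structure KoebeData {ι : Type*} (𝓕 : Set (Finset ι)) (V : ι → Fin 4 → ℚ)
    (N : Finset ι → Fin 4 → ℚ) : Prop where
  time_pos : ∀ v, 0 < V v 3
  self : ∀ v, lor (V v) (V v) = 2
  neg : ∀ u v, u ≠ v → lor (V u) (V v) < 0
  edge : ∀ T ∈ 𝓕, ∀ u ∈ T, ∀ v ∈ T, u ≠ v → lor (V u) (V v) = -2
  facet_time_pos : ∀ T ∈ 𝓕, 0 < N T 3
  -- The value `8` is what makes `N T` plus the three vertex vectors have square `8 - 6 = 2`.
  facet_self : ∀ T ∈ 𝓕, lor (N T) (N T) = 8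
  facet_neg : ∀ T ∈ 𝓕, ∀ S ∈ 𝓕, S ≠ T → lor (N S) (N T) < 0
  mem : ∀ T ∈ 𝓕, ∀ v ∈ T, lor (N T) (V v) = 0
  notMem : ∀ T ∈ 𝓕, ∀ v, v ∉ T → lor (N T) (V v) < 0

lemma KoebeData.supports {ι : Type*} {𝓕 : Set (Finset ι)} {V : ι → Fin 4 → ℚ}
    {N : Finset ι → Fin 4 → ℚ} (h : KoebeData 𝓕 V N) {T : Finset ι} (hT : T ∈ 𝓕) :
    Supports (fun v => toPoint (V v)) T (lorAffine (N T)) :=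
  ⟨fun v hv => lorAffine_toPoint_eq_zero (h.time_pos v) (h.mem T hT v hv),
    fun v hv => lorAffine_toPoint_neg (h.time_pos v) (h.notMem T hT v hv)⟩

lemma KoebeData.sum_time_pos {ι : Type*} {𝓕 : Set (Finset ι)} {V : ι → Fin 4 → ℚ}
    {N : Finset ι → Fin 4 → ℚ} (h : KoebeData 𝓕 V N) (s : Finset ι) :
    0 ≤ (∑ v ∈ s, V v) 3 := by
  rw [Finset.sum_apply]
  exact Finset.sum_nonneg fun v _ => (h.time_pos v).le

section Stack

variable {ι : Type*} [DecidableEq ι] {𝓕 : Set (Finset ι)} {V : ι → Fin 4 → ℚ}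
  {N : Finset ι → Fin 4 → ℚ} {T : Finset ι}

/-- The vertex vector of the point stacked onto `T`. -/
def stackVector (V : ι → Fin 4 → ℚ) (N : Finset ι → Fin 4 → ℚ) (T : Finset ι) : Fin 4 → ℚ :=
  N T + ∑ v ∈ T, V v

/-- The facet vectors after stacking onto `T`. -/
def stackFacetVector (V : ι → Fin 4 → ℚ) (N : Finset ι → Fin 4 → ℚ) (T : Finset ι)
    (U : Finset (Option ι)) : Fin 4 → ℚ :=
  if none ∈ U then N T + (2 : ℚ) • ∑ v ∈ U.eraseNone, V v else N U.eraseNone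

lemma stackFacetVector_map (S : Finset ι) :
    stackFacetVector V N T (S.map Function.Embedding.some) = N S := by
  simp [stackFacetVector]

lemma stackFacetVector_insertNone (a : ι) :
    stackFacetVector V N T (Finset.insertNone (T.erase a)) =
      N T + (2 : ℚ) • ∑ v ∈ T.erase a, V v := by
  simp [stackFacetVector]

lemma lor_sum_right (A : Fin 4 → ℚ) (s : Finset ι) (V : ι → Fin 4 → ℚ) :
    lor A (∑ v ∈ s, V v) = ∑ v ∈ s, lor A (V v) := by
  induction s using Finset.induction_on with
  | empty => simp [lor]
  | insert a s ha ih => rw [Finset.sum_insert ha, Finset.sum_insert ha, lor_add_right, ih]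

lemma KoebeData.lor_stackVector_mem (h : KoebeData 𝓕 V N) (hT : T ∈ 𝓕) (hc : T.card = 3)
    {a : ι} (ha : a ∈ T) : lor (V a) (stackVector V N T) = -2 := by
  rw [stackVector, lor_add_right, lor_comm, h.mem T hT a ha, lor_sum_right,
    ← Finset.add_sum_erase _ _ ha, h.self, Finset.sum_congr rfl (g := fun _ => -2)
      (fun v hv => h.edge T hT a ha v (Finset.mem_of_mem_erase hv) (Finset.ne_of_mem_erase hv).symm),
    Finset.sum_const, Finset.card_erase_of_mem ha, hc]
  norm_num

lemma KoebeData.lor_stackVector_notMem (h : KoebeData 𝓕 V N) (hT : T ∈ 𝓕)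
    {a : ι} (ha : a ∉ T) : lor (V a) (stackVector V N T) < 0 := by
  rw [stackVector, lor_add_right, lor_comm, lor_sum_right]
  exact add_neg_of_neg_of_nonpos (h.notMem T hT a ha)
    (Finset.sum_nonpos fun v hv => (h.neg a v fun e => ha (e ▸ hv)).le)

lemma KoebeData.lor_facet_stackVector (h : KoebeData 𝓕 V N) (hT : T ∈ 𝓕) :
    lor (N T) (stackVector V N T) = 8 := by
  rw [stackVector, lor_add_right, h.facet_self T hT, lor_sum_right,
    Finset.sum_eq_zero (h.mem T hT), add_zero]

lemma KoebeData.lor_vertex_nonpos (h : KoebeData 𝓕 V N) {S : Finset ι} (hS : S ∈ 𝓕) (v : ι) :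
    lor (N S) (V v) ≤ 0 := by
  by_cases hv : v ∈ S
  · exact (h.mem S hS v hv).le
  · exact (h.notMem S hS v hv).le

/-- Negative products between distinct facet normals are what keeps the new vertex beneath all
facets other than `T`; this is the purpose of `facet_neg`. -/
lemma KoebeData.lor_other_facet_stackVector (h : KoebeData 𝓕 V N) (hT : T ∈ 𝓕) {S : Finset ι}
    (hS : S ∈ 𝓕) (hST : S ≠ T) : lor (N S) (stackVector V N T) < 0 := by
  rw [stackVector, lor_add_right, lor_sum_right]
  exact add_neg_of_neg_of_nonpos (h.facet_neg T hT S hS hST)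
    (Finset.sum_nonpos fun v _ => h.lor_vertex_nonpos hS v)

lemma KoebeData.lor_stackVector_self (h : KoebeData 𝓕 V N) (hT : T ∈ 𝓕) (hc : T.card = 3) :
    lor (stackVector V N T) (stackVector V N T) = 2 := by
  nth_rewrite 2 [stackVector]
  rw [lor_add_right, lor_comm, h.lor_facet_stackVector hT, lor_sum_right,
    Finset.sum_congr rfl (g := fun _ => -2) (fun v hv => by
      rw [lor_comm, h.lor_stackVector_mem hT hc hv]), Finset.sum_const, hc]
  norm_num

/-- Lorentz products with the sum of two vertices of `T`. -/
lemma KoebeData.lor_sum_erase_mem (h : KoebeData 𝓕 V N) (hT : T ∈ 𝓕) (hc : T.card = 3)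
    {a b : ι} (ha : a ∈ T) (hb : b ∈ T) :
    lor (V b) (∑ v ∈ T.erase a, V v) = if b = a then -4 else 0 := by
  have hsum : lor (V b) (∑ v ∈ T, V v) = -2 := by
    have := h.lor_stackVector_mem hT hc hb
    rwa [stackVector, lor_add_right, lor_comm, h.mem T hT b hb, zero_add] at this
  rw [← Finset.add_sum_erase _ _ ha, lor_add_right] at hsum
  split_ifs with hab
  · subst hab
    rw [h.self] at hsum
    linarith
  · rw [h.edge T hT b hb a ha hab] at hsum
    linarith

lemma KoebeData.stack (h : KoebeData 𝓕 V N) (h𝓕 : IsTriangulation 𝓕) (hT : T ∈ 𝓕) :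
    KoebeData (stackTriangles 𝓕 T) (addPoint V (stackVector V N T))
      (stackFacetVector V N T) := by
  have hc := h𝓕.card T hT
  have hTpos := h.facet_time_pos T hT
  have hneg : ∀ a, lor (V a) (stackVector V N T) < 0 := fun a => by
    by_cases ha : a ∈ T
    · rw [h.lor_stackVector_mem hT hc ha]; norm_num
    · exact h.lor_stackVector_notMem hT ha
  have herase : ∀ a ∈ T, lor (N T) (∑ v ∈ T.erase a, V v) = 0 := fun a ha => by
    rw [lor_sum_right]
    exact Finset.sum_eq_zero fun v hv => h.mem T hT v (Finset.mem_of_mem_erase hv)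
  have hold : ∀ S ∈ 𝓕, S ≠ T → ∀ a, lor (N S) (N T + (2 : ℚ) • ∑ v ∈ T.erase a, V v) < 0 := by
    intro S hS hST a
    rw [lor_add_right, lor_smul_right, lor_sum_right]
    have h1 := h.facet_neg T hT S hS hST
    have h2 := Finset.sum_nonpos fun v (_ : v ∈ T.erase a) => h.lor_vertex_nonpos hS v
    linarith
  -- The sum of two vertices of `T` is the null vector of the tangency point of their edge; the
  -- vectors of two different edges have product `-4`.
  have hnew : ∀ a ∈ T, ∀ b ∈ T, lor (∑ v ∈ T.erase a, V v) (∑ v ∈ T.erase b, V v) =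
      if a = b then 0 else -4 := by
    intro a ha b hb
    rw [lor_sum_right, Finset.sum_congr rfl (g := fun v => if v = a then (-4 : ℚ) else 0)
      (fun v hv => by rw [lor_comm, h.lor_sum_erase_mem hT hc ha (Finset.mem_of_mem_erase hv)]),
      Finset.sum_ite_eq' (T.erase b) a]
    by_cases hab : a = b
    · simp [hab]
    · simp [hab, ha]
  refine ⟨?_, ?_, ?_, ?_, ?_, ?_, ?_, ?_, ?_⟩
  · rintro (_ | v)
    · exact add_pos_of_pos_of_nonneg hTpos (h.sum_time_pos T)
    · exact h.time_pos v
  · rintro (_ | v)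
    · exact h.lor_stackVector_self hT hc
    · exact h.self v
  · rintro (_ | u) (_ | v) huv
    · exact absurd rfl huv
    · rw [lor_comm]
      exact hneg v
    · exact hneg u
    · exact h.neg u v fun e => huv (by rw [e])
  · rintro _ (⟨S, hS, hST, rfl⟩ | ⟨a, ha, rfl⟩) (_ | u) hu (_ | v) hv huv
    · exact absurd rfl huv
    · simp at hu
    · simp at hv
    · exact h.edge S hS u (by simpa using hu) v (by simpa using hv) fun e => huv (by rw [e])
    · exact absurd rfl huv
    · rw [lor_comm]
      exact h.lor_stackVector_mem hT hc (Finset.mem_of_mem_erase (by simpa using hv : v ∈ T.erase a))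
    · exact h.lor_stackVector_mem hT hc (Finset.mem_of_mem_erase (by simpa using hu : u ∈ T.erase a))
    · exact h.edge T hT u (Finset.mem_of_mem_erase (by simpa using hu : u ∈ T.erase a)) v
        (Finset.mem_of_mem_erase (by simpa using hv : v ∈ T.erase a)) fun e => huv (by rw [e])
  · rintro _ (⟨S, hS, hST, rfl⟩ | ⟨a, ha, rfl⟩)
    · rw [stackFacetVector_map]
      exact h.facet_time_pos S hS
    · rw [stackFacetVector_insertNone, Pi.add_apply, Pi.smul_apply, smul_eq_mul]
      have := h.sum_time_pos (T.erase a)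
      linarith
  · rintro _ (⟨S, hS, hST, rfl⟩ | ⟨a, ha, rfl⟩)
    · rw [stackFacetVector_map]
      exact h.facet_self S hS
    · rw [stackFacetVector_insertNone, lor_add_right, lor_add_left, lor_add_left, lor_smul_right,
        lor_smul_right, lor_smul_left, lor_smul_left, lor_comm (∑ v ∈ T.erase a, V v) (N T),
        herase a ha, hnew a ha a ha, h.facet_self T hT]
      simp
  · rintro _ (⟨S, hS, hST, rfl⟩ | ⟨a, ha, rfl⟩) _ (⟨S', hS', hST', rfl⟩ | ⟨b, hb, rfl⟩) hne
    · rw [stackFacetVector_map, stackFacetVector_map]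
      exact h.facet_neg S hS S' hS' fun e => hne (by rw [e])
    · rw [stackFacetVector_map, stackFacetVector_insertNone, lor_comm]
      exact hold S hS hST b
    · rw [stackFacetVector_map, stackFacetVector_insertNone]
      exact hold S' hS' hST' a
    -- Two new normals have product `8 + 4 * (-4) = -8`.
    · have hba : b ≠ a := fun e => hne (by rw [e])
      rw [stackFacetVector_insertNone, stackFacetVector_insertNone, lor_add_right, lor_add_left,
        lor_add_left, lor_smul_right, lor_smul_right, lor_smul_left, lor_smul_left,
        lor_comm (∑ v ∈ T.erase b, V v) (N T), herase a ha, herase b hb, hnew b hb a ha, h.facet_self T hT,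
        if_neg hba]
      norm_num
  · rintro _ (⟨S, hS, hST, rfl⟩ | ⟨a, ha, rfl⟩) (_ | v) hv
    · simp at hv
    · rw [stackFacetVector_map]
      exact h.mem S hS v (by simpa using hv)
    -- The coefficient `2` in the new normal is forced here: `8 + 2 * (-4) = 0`.
    · rw [stackFacetVector_insertNone, addPoint_none, lor_add_left, lor_smul_left,
        h.lor_facet_stackVector hT, lor_comm, lor_sum_right,
        Finset.sum_congr rfl (g := fun _ => (-2 : ℚ)) (fun v hv => by
          rw [lor_comm, h.lor_stackVector_mem hT hc (Finset.mem_of_mem_erase hv)]),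
        Finset.sum_const, Finset.card_erase_of_mem ha, hc]
      norm_num
    · have hv' : v ≠ a ∧ v ∈ T := by simpa using hv
      rw [stackFacetVector_insertNone, addPoint_some, lor_add_left, lor_smul_left,
        h.mem T hT v hv'.2, lor_comm, h.lor_sum_erase_mem hT hc ha hv'.2, if_neg hv'.1]
      norm_num
  · rintro _ (⟨S, hS, hST, rfl⟩ | ⟨a, ha, rfl⟩) (_ | v) hv
    · rw [stackFacetVector_map]
      exact h.lor_other_facet_stackVector hT hS hST
    · rw [stackFacetVector_map]
      exact h.notMem S hS v (by simpa using hv)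
    · simp at hv
    · rw [stackFacetVector_insertNone, addPoint_some, lor_add_left, lor_smul_left]
      by_cases hvT : v ∈ T
      · have hva : v = a := by
          by_contra hva
          exact hv (by simp [hva, hvT])
        rw [h.mem T hT v hvT, lor_comm, h.lor_sum_erase_mem hT hc ha hvT, if_pos hva]
        norm_num
      · have h1 := h.notMem T hT v hvT
        rw [lor_comm (∑ v ∈ T.erase a, V v), lor_sum_right]
        have h2 := Finset.sum_nonpos fun u (hu : u ∈ T.erase a) =>
          (h.neg v u fun e => hvT (e ▸ Finset.mem_of_mem_erase hu)).le
        linarith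

end Stack

/-! ### The regular tetrahedron as base case. -/

/-- Homogeneous coordinates of the vertices of a regular tetrahedron. -/
def tetrahedronVector : Fin 4 → Fin 4 → ℚ :=
  ![![1, 1, 1, 1], ![1, -1, -1, 1], ![-1, 1, -1, 1], ![-1, -1, 1, 1]]

/-- The facet vectors of the regular tetrahedron, by opposite vertex. -/
def tetrahedronNormal : Fin 4 → Fin 4 → ℚ :=
  ![![-2, -2, -2, 2], ![-2, 2, 2, 2], ![2, -2, 2, 2], ![2, 2, -2, 2]]

lemma lor_tetrahedronVector (i j : Fin 4) :
    lor (tetrahedronVector i) (tetrahedronVector j) = if i = j then 2 else -2 := by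
  fin_cases i <;> fin_cases j <;> simp [lor, tetrahedronVector] <;> norm_num

lemma lor_tetrahedronNormal (i j : Fin 4) :
    lor (tetrahedronNormal i) (tetrahedronNormal j) = if i = j then 8 else -8 := by
  fin_cases i <;> fin_cases j <;> simp [lor, tetrahedronNormal] <;> norm_num

lemma lor_tetrahedronNormal_vector (i j : Fin 4) :
    lor (tetrahedronNormal i) (tetrahedronVector j) = if i = j then -8 else 0 := by
  fin_cases i <;> fin_cases j <;> simp [lor, tetrahedronNormal, tetrahedronVector] <;> norm_num

lemma exists_koebeData_tetrahedron :
    ∃ N, KoebeData tetrahedronTriangles tetrahedronVector N := by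
  classical
  -- On a triangle the complement is a single vertex, so the sum picks out the normal opposite to
  -- it; other sets get irrelevant values.
  refine ⟨fun T => ∑ i ∈ Tᶜ, tetrahedronNormal i, ?_⟩
  have hN : ∀ i, (∑ j ∈ (Finset.univ.erase i)ᶜ, tetrahedronNormal j) = tetrahedronNormal i :=
    fun i => by
      rw [show (Finset.univ.erase i)ᶜ = {i} by ext; simp, Finset.sum_singleton]
  refine ⟨?_, ?_, ?_, ?_, ?_, ?_, ?_, ?_, ?_⟩
  · intro v
    fin_cases v <;> simp [tetrahedronVector]
  · intro v
    simp [lor_tetrahedronVector]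
  · intro u v huv
    simp [lor_tetrahedronVector, huv]
  · intro T _ u _ v _ huv
    simp [lor_tetrahedronVector, huv]
  · rintro _ ⟨i, rfl⟩
    rw [hN]
    fin_cases i <;> simp [tetrahedronNormal]
  · rintro _ ⟨i, rfl⟩
    rw [hN, lor_tetrahedronNormal, if_pos rfl]
  · rintro _ ⟨i, rfl⟩ _ ⟨j, rfl⟩ hne
    rw [hN, hN, lor_tetrahedronNormal, if_neg fun e => hne (by rw [e])]
    norm_num
  · rintro _ ⟨i, rfl⟩ v hv
    rw [hN, lor_tetrahedronNormal_vector, if_neg fun e => by simp [e] at hv]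
  · rintro _ ⟨i, rfl⟩ v hv
    rw [hN, lor_tetrahedronNormal_vector, if_pos (by simpa [eq_comm] using hv)]
    norm_num

lemma affineIndependent_tetrahedronVector :
    AffineIndependent ℝ fun i => toPoint (tetrahedronVector i) := by
  obtain ⟨N, h⟩ := exists_koebeData_tetrahedron
  refine affineIndependent_of_dual (fun i => lorAffine (N (Finset.univ.erase i)))
    (fun i j hij => ?_) fun i => ?_
  · exact (h.supports (mem_range_self i)).1 j (by simp [hij.symm])
  · exact ((h.supports (mem_range_self i)).2 i (by simp)).ne

/-! ### Induction over stackings and the Koebe degree. -/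

/-- A stacked polytope shares its triangles with a rational edge-tangent polytope. -/
lemma IsStacked.exists_koebeData {P : Set E3} (hP : IsStacked P) :
    ∃ (ι : Type) (_ : Fintype ι) (_ : DecidableEq ι) (𝓕 : Set (Finset ι)) (p : ι → E3)
      (V : ι → Fin 4 → ℚ) (N : Finset ι → Fin 4 → ℚ), IsTriangulation 𝓕 ∧
      P = convexHull ℝ (range p) ∧ Realizes p 𝓕 ∧ Realizes (fun v => toPoint (V v)) 𝓕 ∧
      KoebeData 𝓕 V N := by
  induction hP with
  | simplex p hp =>
    obtain ⟨N, hN⟩ := exists_koebeData_tetrahedron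
    exact ⟨Fin 4, inferInstance, inferInstance, tetrahedronTriangles, p, tetrahedronVector, N,
      isTriangulation_tetrahedron, rfl, realizes_tetrahedron hp,
      realizes_tetrahedron affineIndependent_tetrahedronVector, hN⟩
  | stack P F y _ hF hy hG ih =>
    obtain ⟨ι, _, _, 𝓕, p, V, N, h𝓕, rfl, hp, hq, hN⟩ := ih
    obtain ⟨T, hT, rfl⟩ := hp.exists_of_isFacet h𝓕 hF
    refine ⟨Option ι, inferInstance, inferInstance, stackTriangles 𝓕 T, addPoint p y,
      addPoint V (stackVector V N T), stackFacetVector V N T, h𝓕.stack hT, ?_,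
      hp.stack h𝓕 hT ?_ ?_, ?_, hN.stack h𝓕 hT⟩
    · rw [range_addPoint, insert_eq, insert_eq, convexHull_convexHull_union_right]
    · obtain ⟨l, c, hl, he, hlt⟩ := hy
      exact ⟨_, Realizes.supports_of_facet_eq (hp.supp T hT) hl he, by simpa using hlt⟩
    · intro S hS hST
      obtain ⟨f, hf⟩ := hp.supp S hS
      obtain ⟨g, hg⟩ := hp.supp T hT
      -- Distinct triangles span distinct facets, since a face determines the vertices it contains.
      obtain ⟨l, c, hl, he, hlt⟩ := hG _ (hp.isFacet h𝓕 hS) fun e => hST (by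
        ext v
        rw [← Realizes.mem_convexHull_image_iff hf, e, Realizes.mem_convexHull_image_iff hg])
      exact ⟨_, Realizes.supports_of_facet_eq ⟨f, hf⟩ hl he, by simpa using hlt⟩
    · have hpos := (hN.stack h𝓕 hT).time_pos none
      have := hq.stack h𝓕 hT (y := toPoint (stackVector V N T))
        ⟨_, hN.supports hT, lorAffine_toPoint_pos hpos
          (by rw [hN.lor_facet_stackVector hT]; norm_num)⟩
        fun S hS hST => ⟨_, hN.supports hS, lorAffine_toPoint_neg hpos
          (hN.lor_other_facet_stackVector hT hS hST)⟩
      convert this using 1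
      ext (_ | v) <;> rfl

lemma IsStacked.exists_rational_koebeRealization {P : Set E3} (hP : IsStacked P) :
    ∃ Q : Set E3, IsKoebeRealization P Q ∧
      ∀ v ∈ vertices Q, ∀ i : Fin 3, ∃ q : ℚ, v i = (q : ℝ) := by
  obtain ⟨ι, _, _, 𝓕, p, V, N, h𝓕, rfl, hp, hq, hN⟩ := hP.exists_koebeData
  refine ⟨convexHull ℝ (range fun v => toPoint (V v)), ⟨hq.isThreePolytope h𝓕,
    ⟨(hp.faceOrderIso h𝓕).symm.trans (hq.faceOrderIso h𝓕)⟩, ?_⟩, ?_⟩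
  · intro e he
    obtain ⟨T, hT, u, hu, v, hv, huv, rfl⟩ := hq.exists_of_isEdge h𝓕 he
    exact tangentToSphere_segment (hN.time_pos u) (hN.time_pos v) (hN.self u) (hN.self v)
      (hN.edge T hT u hu v hv huv)
  · intro v hv i
    obtain ⟨w, rfl⟩ := extremePoints_convexHull_subset hv
    exact toPoint_rational (V w) i

lemma coordField_eq_bot {Q : Set E3}
    (hQ : ∀ v ∈ vertices Q, ∀ i : Fin 3, ∃ q : ℚ, v i = (q : ℝ)) : coordField Q = ⊥ := by
  rw [coordField, IntermediateField.adjoin_eq_bot_iff]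
  rintro _ ⟨v, hv, i, rfl⟩
  obtain ⟨q, hq⟩ := hQ v hv i
  exact IntermediateField.mem_bot.2 ⟨q, by simp [hq]⟩

lemma koebeDegree_eq_one {P Q : Set E3} (hPQ : IsKoebeRealization P Q)
    (hQ : ∀ v ∈ vertices Q, ∀ i : Fin 3, ∃ q : ℚ, v i = (q : ℝ)) : koebeDegree P = 1 := by
  apply le_antisymm
  · refine (iInf₂_le Q hPQ).trans ?_
    rw [coordField_eq_bot hQ, IntermediateField.rank_bot]
    simp
  · refine le_iInf₂ fun Q' _ => ?_
    have h : (1 : Cardinal) ≤ Module.rank ℚ (coordField Q') :=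
      Cardinal.one_le_iff_pos.2 rank_pos
    simpa using Cardinal.toENat.monotone' h

end KoebePolytope

theorem theorem4p2 (P : Set KoebePolytope.E3) (hP : KoebePolytope.IsStacked P) :
    (∃ Q : Set KoebePolytope.E3, KoebePolytope.IsKoebeRealization P Q ∧
      ∀ v ∈ KoebePolytope.vertices Q, ∀ i : Fin 3, ∃ q : ℚ, v i = (q : ℝ)) ∧
    KoebePolytope.koebeDegree P = 1 := by
  obtain ⟨Q, hPQ, hQ⟩ := hP.exists_rational_koebeRealization
  exact ⟨⟨Q, hPQ, hQ⟩, KoebePolytope.koebeDegree_eq_one hPQ hQ⟩
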